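/- Let $\mathcal{E}$ be a cartesian closed category with finite coproducts, with exponential objects written $X\pitchfork Y$, and let $T=(T,\eta,\mu)$ be a strong commutative monad on $\mathcal{E}$, with tensorial strengths $t''_{X,Y}:X\times T(Y)\to T(X\times Y)$ and $t'_{X,Y}:T(X)\times Y\to T(X\times Y)$. Commutative means that the two maps $\otimes,\tilde\otimes:T(X)\times T(Y)\to T(X\times Y)$ built from $t'$, $t''$ and $\mu$ agree. Put $R:=T(\mathbf 1)$; it acts on every $T(X)$ by $R\times T(X)\xrightarrow{\otimes}T(\mathbf 1\times X)\cong T(X)$, and for $X=\mathbf 1$ this is the multiplication of $R$. Assume that $T(\emptyset)$ is terminal, that the canonical maps $T(X+Y)\to T(X)\times T(Y)$ are isomorphisms (so every $T(X)$ has a zero and an addition $T(X)\times T(X)\cong T(X+X)\to T(X)$, the last map being $T$ of the codiagonal), and that $1\in R$ (that is, $\eta_{\mathbf 1}$) has an additive inverse. Then $R$ is a commutative ring object and every $T(X)$ is an $R$-module object. Elements below are generalized elements, over an arbitrary stage $I\in\mathcal{E}$. Let $D\subseteq R$ be the subobject of those $d\in R$ with $d^2=0$, and assume that every $R$-module $T(X)$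 has the Kock-Lawvere property: for every object $Y$ and every $F:Y\times D\to T(X)$ there is a unique $f':Y\to T(X)$ with $F(y,d)=F(y,0)+d\cdot f'(y)$ for all $d\in D$. For $u\in R$ let $\alpha^u:R\to R$ be the translation $x\mapsto x+u$. For $P\in T(R)$ let $P'\in T(R)$ be the unique element with $d\cdot P'=\alpha^d_*(P)-P$ for all $d\in D$, where $\alpha^d_*=T(\alpha^d)$ (formed internally, by means of the strength, for generalized elements $d$). For $\phi\in R\pitchfork R$ let $\phi'\in R\pitchfork R$ be the unique element with $\phi(x+d)=\phi(x)+d\cdot\phi'(x)$ for all $x\in R$, $d\in D$. Let $\vdash\;:T(X)\times(X\pitchfork R)\to T(X)$ be the unique map that is $T$-linear in the first variable and satisfies $\eta(x)\vdash\phi=\phi(x)\cdot\eta(x)$. Then for all $P\in T(R)$ and $\phi\in R\pitchfork R$, $$(P\vdash\phi)'=P'\vdash\phi-P\vdash\phi'.$$ -/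

import Mathlib

open CategoryTheory CategoryTheory.Limits MonoidalCategory CartesianMonoidalCategory

universe v u

namespace SynthDist

variable {C : Type u} [Category.{v} C] [CartesianMonoidalCategory C]

/-- The twist map `X × Y ⟶ Y × X`. -/
def twist (X Y : C) : X ⊗ Y ⟶ Y ⊗ X := lift (snd X Y) (fst X Y)

/-- A strength, in tensorial form, on a monad `T` on a category with finite products: natural maps
`t'' : X × T Y ⟶ T (X × Y)` compatible with the product structure (`unit`, `assoc`), for which
the unit and the multiplication of the monad are strong natural transformations. -/
class Strength (T : Monad C) where
  t'' (X Y : C) : X ⊗ T.obj Y ⟶ T.obj (X ⊗ Y)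
  naturality {X X' Y Y' : C} (f : X ⟶ X') (g : Y ⟶ Y') :
    (f ⊗ₘ T.map g) ≫ t'' X' Y' = t'' X Y ≫ T.map (f ⊗ₘ g)
  unit (Y : C) : t'' (𝟙_ C) Y ≫ T.map (λ_ Y).hom = (λ_ (T.obj Y)).hom
  assoc (X Y Z : C) :
    t'' (X ⊗ Y) Z ≫ T.map (α_ X Y Z).hom =
      (α_ X Y (T.obj Z)).hom ≫ X ◁ t'' Y Z ≫ t'' X (Y ⊗ Z)
  strong_η (X Y : C) : X ◁ T.η.app Y ≫ t'' X Y = T.η.app (X ⊗ Y)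
  strong_μ (X Y : C) :
    X ◁ T.μ.app Y ≫ t'' X Y = t'' X (T.obj Y) ≫ T.map (t'' X Y) ≫ T.μ.app (X ⊗ Y)

section Strong

variable (T : Monad C) [Strength T]

/-- The strength `t''` of the monad `T`. -/
def tr (X Y : C) : X ⊗ T.obj Y ⟶ T.obj (X ⊗ Y) := Strength.t'' X Y

/-- The twin sister `t'` of `t''`, obtained by conjugation with the twist maps. -/
def tl (X Y : C) : T.obj X ⊗ Y ⟶ T.obj (X ⊗ Y) :=
  twist (T.obj X) Y ≫ tr T Y X ≫ T.map (twist Y X)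

/-- The Fubini map `⊗`, the 2-linear extension of `t'`. -/
def fubini (X Y : C) : T.obj X ⊗ T.obj Y ⟶ T.obj (X ⊗ Y) :=
  tr T (T.obj X) Y ≫ T.map (tl T X Y) ≫ T.μ.app (X ⊗ Y)

/-- The other Fubini map, the 1-linear extension of `t''`. -/
def fubini' (X Y : C) : T.obj X ⊗ T.obj Y ⟶ T.obj (X ⊗ Y) :=
  tl T X (T.obj Y) ≫ T.map (tr T X Y) ≫ T.μ.app (X ⊗ Y)

/-- A strong monad is commutative if its two Fubini maps agree. -/
class IsCommutative : Prop where
  fubini_eq (X Y : C) : fubini T X Y = fubini' T X Y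

/-- The object of scalars `R = T(1)`. -/
abbrev R : C := T.obj (𝟙_ C)

/-- The (convolution) action of `R` on `T(X)`. -/
def act (X : C) : R T ⊗ T.obj X ⟶ T.obj X := fubini T (𝟙_ C) X ≫ T.map (λ_ X).hom

/-- The unique extension of `f : X × Y ⟶ T(Z)` over `η × Y` to a map `T(X) × Y ⟶ T(Z)` that
is `T`-linear in the first variable. -/
def ext₁ {X Y Z : C} (f : X ⊗ Y ⟶ T.obj Z) : T.obj X ⊗ Y ⟶ T.obj Z :=
  tl T X Y ≫ T.map f ≫ T.μ.app Z

section Closed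

variable [MonoidalClosed C]

/-- The evaluation map `X × (X ⋔ Y) ⟶ Y`. -/
def ev (X Y : C) : X ⊗ (ihom X).obj Y ⟶ Y := (ihom.ev X).app Y

/-- The map `ρ : X × (X ⋔ R) ⟶ T(X)`, `(x, φ) ↦ φ(x) · η(x)`. -/
def rho (X : C) : X ⊗ (ihom X).obj (R T) ⟶ T.obj X :=
  lift (ev X (R T)) (fst X _) ≫ tl T (𝟙_ C) X ≫ T.map (λ_ X).hom

/-- The action `⊢ : T(X) × (X ⋔ R) ⟶ T(X)` of functions on distributions. -/
def dashMap (X : C) : T.obj X ⊗ (ihom X).obj (R T) ⟶ T.obj X := ext₁ T (rho T X)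

variable {T}

/-- `P ⊢ φ` for generalized elements `P ∈ T(X)` and `φ ∈ X ⋔ R` (at stage `I`). -/
def dash {I X : C} (P : I ⟶ T.obj X) (φ : I ⟶ (ihom X).obj (R T)) : I ⟶ T.obj X :=
  lift P φ ≫ dashMap T X

end Closed

variable {T}

/-- `r · P` for generalized elements `r ∈ R` and `P ∈ T(X)`. With `X = 1` this is the
multiplication of `R`. -/
def smul {I X : C} (r : I ⟶ R T) (P : I ⟶ T.obj X) : I ⟶ T.obj X := lift r P ≫ act T X

end Strong

section Additive

variable [HasInitial C] [HasBinaryCoproducts C]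

/-- The canonical map `T(∅) ⟶ 1` is an isomorphism. -/
class HasZeroAlg (T : Monad C) : Prop where
  isIso_toUnit : IsIso (toUnit (T.obj (⊥_ C)))

attribute [instance] HasZeroAlg.isIso_toUnit

/-- The zero `1 ≅ T(∅) ⟶ T(X)` of `T(X)`, as a generalized element at stage `I`. -/
noncomputable def zero (T : Monad C) [HasZeroAlg T] (I X : C) : I ⟶ T.obj X :=
  toUnit I ≫ inv (toUnit (T.obj (⊥_ C))) ≫ T.map (initial.to X)

/-- The `T`-linear extension `T(X) ⟶ T(Y)` of `f : X ⟶ T(Y)`. -/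
def linExt (T : Monad C) {X Y : C} (f : X ⟶ T.obj Y) : T.obj X ⟶ T.obj Y :=
  T.map f ≫ T.μ.app Y

/-- The canonical map `T(X + Y) ⟶ T(X) × T(Y)` from the coproduct of the free algebras on `X` and
`Y` to their product. -/
noncomputable def biprodMap (T : Monad C) [HasZeroAlg T] (X Y : C) :
    T.obj (X ⨿ Y) ⟶ T.obj X ⊗ T.obj Y :=
  lift (linExt T (coprod.desc (T.η.app X) (zero T Y X)))
    (linExt T (coprod.desc (zero T X Y) (T.η.app Y)))

/-- The category of free `T`-algebras has a zero object and biproducts. -/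
class HasBiprodAlg (T : Monad C) : Prop extends HasZeroAlg T where
  isIso_biprodMap (X Y : C) : IsIso (biprodMap T X Y)

attribute [instance] HasBiprodAlg.isIso_biprodMap

/-- The addition `T(X) × T(X) ≅ T(X + X) ⟶ T(X)`. -/
noncomputable def addMap (T : Monad C) [HasBiprodAlg T] (X : C) :
    T.obj X ⊗ T.obj X ⟶ T.obj X :=
  inv (biprodMap T X X) ≫ T.map (coprod.desc (𝟙 X) (𝟙 X))

/-- `P + Q` for generalized elements of `T(X)`. -/
noncomputable def add {T : Monad C} [HasBiprodAlg T] {I X : C} (P Q : I ⟶ T.obj X) :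
    I ⟶ T.obj X :=
  lift P Q ≫ addMap T X

/-- The unit `1 ∈ R` has an additive inverse. -/
class IsAdditive (T : Monad C) : Prop extends HasBiprodAlg T where
  exists_neg_one : ∃ n : 𝟙_ C ⟶ R T, add (T.η.app (𝟙_ C)) n = zero T (𝟙_ C) (𝟙_ C)

/-- The scalar `-1`. -/
noncomputable def negOne (T : Monad C) [IsAdditive T] : 𝟙_ C ⟶ R T :=
  (IsAdditive.exists_neg_one (T := T)).choose

variable {T : Monad C} [Strength T] [IsAdditive T]

/-- `P - Q := P + (-1) · Q` for generalized elements of `T(X)`. -/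
noncomputable def sub {I X : C} (P Q : I ⟶ T.obj X) : I ⟶ T.obj X :=
  add P (smul (toUnit I ≫ negOne T) Q)

variable (T) in
/-- A subobject `D` of `R` containing `0`. -/
structure Infinitesimals where
  obj : C
  ι : obj ⟶ R T
  mono : Mono ι
  pt : 𝟙_ C ⟶ obj
  pt_ι : pt ≫ ι = zero T (𝟙_ C) (𝟙_ C)

/-- `D` consists of the `d ∈ R` with `d² = 0`: a generalized element of `R` belongs to `D` if and
only if its square is zero. -/
def Infinitesimals.IsSquareZero (D : Infinitesimals T) : Prop :=
  ∀ ⦃I : C⦄ (r : I ⟶ R T),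
    (∃ d : I ⟶ D.obj, d ≫ D.ι = r) ↔ smul r r = zero T I (𝟙_ C)

/-- `F(i, d) = F(i, 0) + d · f'(i)` for all `d ∈ D`. -/
def IsSlope (D : Infinitesimals T) {I X : C} (F : I ⊗ D.obj ⟶ T.obj X) (f' : I ⟶ T.obj X) :
    Prop :=
  F = add (lift (fst I D.obj) (toUnit _ ≫ D.pt) ≫ F)
    (smul (snd I D.obj ≫ D.ι) (fst I D.obj ≫ f'))

/-- The Kock-Lawvere property of the `R`-module `T(X)`, relative to `D`. -/
def IsKL (D : Infinitesimals T) (X : C) : Prop :=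
  ∀ ⦃I : C⦄ (F : I ⊗ D.obj ⟶ T.obj X), ∃! f' : I ⟶ T.obj X, IsSlope D F f'

/-- The unique `f'` provided by the Kock-Lawvere property. -/
noncomputable def slope {D : Infinitesimals T} {I X : C} (h : IsKL D X)
    (F : I ⊗ D.obj ⟶ T.obj X) : I ⟶ T.obj X :=
  (h F).choose

/-- `αᵘ_*(P)`, the direct image of `P ∈ T(R)` under the translation `x ↦ x + u`. -/
noncomputable def translate {I : C} (u : I ⟶ R T) (P : I ⟶ T.obj (R T)) : I ⟶ T.obj (R T) :=
  lift P u ≫ tl T (R T) (R T) ≫ T.map (addMap T (𝟙_ C))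

/-- The derivative `P'` of a distribution `P ∈ T(R)`: the unique `P'` such that
`αᵈ_*(P) = P + d · P'` for all `d ∈ D`. -/
noncomputable def distDeriv {D : Infinitesimals T} (h : IsKL D (R T)) {I : C}
    (P : I ⟶ T.obj (R T)) : I ⟶ T.obj (R T) :=
  slope h (translate (snd I D.obj ≫ D.ι) (fst I D.obj ≫ P))

/-- The derivative `φ'` of a function `φ ∈ R ⋔ T(X)`: the unique `φ'` such that
`φ(x + d) = φ(x) + d · φ'(x)` for all `x ∈ R` and `d ∈ D`. -/
noncomputable def funDeriv [MonoidalClosed C] {D : Infinitesimals T} {X : C} (h : IsKL D X) {I : C}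
    (φ : I ⟶ (ihom (R T)).obj (T.obj X)) : I ⟶ (ihom (R T)).obj (T.obj X) :=
  MonoidalClosed.curry <| slope h (I := R T ⊗ I) <|
    lift (add (fst _ D.obj ≫ fst (R T) I) (snd _ D.obj ≫ D.ι))
      (fst _ D.obj ≫ snd (R T) I ≫ φ) ≫ ev (R T) (T.obj X)

end Additive

end SynthDist

/-! Everything is rewritten through `bind P k`, read as integrating a parametrized family `k`
against the distribution `P`. The strong monad axioms give its unit and associativity laws;
commutativity gives Fubini (`bind_comm`), so scalars pass through an integral; the biproducts make
it additive in both arguments. For generic `d ∈ D`, integrating `φ(x+d) · η(x+d)` against `P` gives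
`α^d_*(P) ⊢ φ`. Expanding `φ(x+d) = φ(x) + d · φ'(x)` yields `α^d_*(P) ⊢ φ = α^d_*(P ⊢ φ) + d ·
α^d_*(P ⊢ φ')` (`dash_translate_eq_add`). Since `d² = 0`, the translation in the last term may be
dropped (`smul_translate`), while the left side is `P ⊢ φ + d · (P' ⊢ φ)`. Hence `P' ⊢ φ - P ⊢ φ'`
is a slope of `d ↦ α^d_*(P ⊢ φ)`, and slopes are unique. -/

namespace SynthDist

/-! ### Calculus of parametrized Kleisli extension, Fubini, and the scalar action. -/

section Bind

variable {C : Type u} [Category.{v} C] [CartesianMonoidalCategory C]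
  {T : Monad C} [Strength T]

/-- Binding a generalized element `P` of `T(X)` to a map `k` into `T(Y)` depending on parameters:
the `T`-linear extension of `k` in its second variable, evaluated at `P`. -/
def bind {I X Y : C} (P : I ⟶ T.obj X) (k : I ⊗ X ⟶ T.obj Y) : I ⟶ T.obj Y :=
  lift (𝟙 I) P ≫ tr T I X ≫ T.map k ≫ T.μ.app Y

lemma whiskerRight_tr {X X' : C} (f : X ⟶ X') (Y : C) :
    f ▷ T.obj Y ≫ tr T X' Y = tr T X Y ≫ T.map (f ▷ Y) := by
  simpa [tr] using Strength.naturality (T := T) f (𝟙 Y)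

lemma whiskerLeft_map_tr (X : C) {Y Y' : C} (g : Y ⟶ Y') :
    X ◁ T.map g ≫ tr T X Y' = tr T X Y ≫ T.map (X ◁ g) := by
  simpa [tr] using Strength.naturality (T := T) (𝟙 X) g

/-- Naturality along `X ⟶ 1` reduces this to the unit axiom of the strength. It lets parameter-free
extensions be treated as instances of `bind`. -/
lemma tr_snd (X Y : C) : tr T X Y ≫ T.map (snd X Y) = snd X (T.obj Y) := by
  have h := whiskerRight_tr (T := T) (toUnit X) Y
  have h' := Strength.unit (T := T) Y
  have e : snd X Y = toUnit X ▷ Y ≫ (λ_ Y).hom :=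
    (whiskerRight_toUnit_comp_leftUnitor_hom X Y).symm
  rw [e, T.map_comp, ← Category.assoc, ← h, Category.assoc]
  exact (congrArg _ h').trans (whiskerRight_toUnit_comp_leftUnitor_hom X (T.obj Y))

lemma lift_bind_tr {I J X Y : C} (f : I ⟶ J) (P : I ⟶ T.obj X) (k : J ⊗ X ⟶ T.obj Y) :
    lift f P ≫ tr T J X ≫ T.map k ≫ T.μ.app Y = bind P (f ▷ X ≫ k) := by
  have : lift f P = lift (𝟙 I) P ≫ f ▷ T.obj X := by simp
  rw [this, bind, Category.assoc, ← Category.assoc (f ▷ _), whiskerRight_tr]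
  simp

lemma comp_bind {I J X Y : C} (f : I ⟶ J) (P : J ⟶ T.obj X) (k : J ⊗ X ⟶ T.obj Y) :
    f ≫ bind P k = bind (f ≫ P) (f ▷ X ≫ k) := by
  rw [← lift_bind_tr, bind, ← Category.assoc]
  simp

lemma η_bind {I X Y : C} (x : I ⟶ X) (k : I ⊗ X ⟶ T.obj Y) :
    bind (x ≫ T.η.app X) k = lift (𝟙 I) x ≫ k := by
  have : lift (𝟙 I) (x ≫ T.η.app X) = lift (𝟙 I) x ≫ I ◁ T.η.app X := by simp
  have h := Strength.strong_η (T := T) I X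
  rw [bind, this, Category.assoc, ← Category.assoc (I ◁ _)]
  erw [h]
  have h2 := T.η.naturality k
  simp only [Functor.id_map] at h2
  rw [← Category.assoc (T.η.app _), ← h2]
  simp

lemma linExt_eq_bind {I X Y : C} (P : I ⟶ T.obj X) (f : X ⟶ T.obj Y) :
    P ≫ linExt T f = bind P (snd I X ≫ f) := by
  rw [bind, T.map_comp, ← Category.assoc (tr _ _ _), ← Category.assoc (tr _ _ _), tr_snd]
  simp [linExt]

lemma map_eq_bind {I X Y : C} (P : I ⟶ T.obj X) (f : X ⟶ Y) :
    P ≫ T.map f = bind P (snd I X ≫ f ≫ T.η.app Y) := by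
  rw [← linExt_eq_bind]
  simp [linExt]

lemma bind_η {I X : C} (P : I ⟶ T.obj X) : bind P (snd I X ≫ T.η.app X) = P := by
  have := map_eq_bind P (𝟙 X)
  simpa using this.symm

/-- The parameter in `I` is used twice, so it is duplicated by the diagonal; the associativity axiom
of the strength then separates the copies, and `strong_μ` with monad associativity does the rest. -/
lemma bind_assoc {I X Y Z : C} (P : I ⟶ T.obj X) (k : I ⊗ X ⟶ T.obj Y) (l : I ⊗ Y ⟶ T.obj Z) :
    bind (bind P k) l = bind P (bind k (fst I X ▷ Y ≫ l)) := by
  have hμ := Strength.strong_μ (T := T) I Y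
  have ha := Strength.assoc (T := T) I I X
  change I ◁ T.μ.app Y ≫ tr T I Y = tr T I (T.obj Y) ≫ T.map (tr T I Y) ≫ T.μ.app (I ⊗ Y) at hμ
  change tr T (I ⊗ I) X ≫ T.map (α_ I I X).hom =
      (α_ I I (T.obj X)).hom ≫ I ◁ tr T I X ≫ tr T I (I ⊗ X) at ha
  have hr : bind k (fst I X ▷ Y ≫ l) =
      lift (fst I X) k ≫ tr T I Y ≫ T.map l ≫ T.μ.app Z := (lift_bind_tr _ _ _).symm
  have e : lift (𝟙 I) (bind P k) = lift (𝟙 I) P ≫ lift (𝟙 I) (𝟙 I) ▷ T.obj X ≫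
      (α_ I I (T.obj X)).hom ≫ I ◁ tr T I X ≫ I ◁ T.map k ≫ I ◁ T.μ.app Y := by
    ext <;> simp [bind]
  have e2 : lift (fst I X) k = lift (𝟙 I) (𝟙 I) ▷ X ≫ (α_ I I X).hom ≫ I ◁ k := by
    ext
    · simp
    · simp only [Category.assoc, whiskerLeft_snd, lift_snd]
      simp only [← Category.assoc]
      convert (Category.id_comp k).symm using 2
      ext <;> simp
  have hμl := T.μ.naturality l
  have hk := whiskerLeft_map_tr (T := T) I k
  have hd := whiskerRight_tr (T := T) (lift (𝟙 I) (𝟙 I)) X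
  have hμt := T.assoc Z
  calc bind (bind P k) l
      = lift (𝟙 I) P ≫ lift (𝟙 I) (𝟙 I) ▷ T.obj X ≫ ((α_ I I (T.obj X)).hom ≫ I ◁ tr T I X ≫
        (I ◁ T.map k ≫ (I ◁ T.μ.app Y ≫ tr T I Y))) ≫ T.map l ≫ T.μ.app Z := by
        rw [bind, e]; simp
    _ = lift (𝟙 I) P ≫ (lift (𝟙 I) (𝟙 I) ▷ T.obj X ≫ tr T (I ⊗ I) X) ≫ T.map (α_ I I X).hom ≫
        T.map (I ◁ k) ≫ T.map (tr T I Y) ≫ (T.μ.app (I ⊗ Y) ≫ T.map l) ≫ T.μ.app Z := by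
        rw [hμ, ← Category.assoc (I ◁ T.map k), hk]
        have := congr($ha ≫ T.map (I ◁ k) ≫ T.map (tr T I Y) ≫ (T.μ.app (I ⊗ Y) ≫ T.map l) ≫ T.μ.app Z)
        simp only [Category.assoc] at this ⊢
        rw [this]
    _ = _ := by
        rw [hd, ← hμl, hr, bind, e2]
        simp [Monad.assoc]

lemma ext₁_eq_bind {I X Y Z : C} (P : I ⟶ T.obj X) (y : I ⟶ Y) (f : X ⊗ Y ⟶ T.obj Z) :
    lift P y ≫ ext₁ T f = bind P (lift (snd I X) (fst I X ≫ y) ≫ f) := by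
  have e : lift (snd I X) (fst I X ≫ y) ≫ f = y ▷ X ≫ twist Y X ≫ f := by
    rw [← Category.assoc]; congr 1; ext <;> simp [twist]
  rw [e, ← lift_bind_tr]
  have e' : lift P y ≫ twist (T.obj X) Y = lift y P := by ext <;> simp [twist]
  simp [ext₁, tl, ← e']

lemma tl_eq_bind {I X Y : C} (P : I ⟶ T.obj X) (y : I ⟶ Y) :
    lift P y ≫ tl T X Y = bind P (lift (snd I X) (fst I X ≫ y) ≫ T.η.app (X ⊗ Y)) := by
  rw [← ext₁_eq_bind]; simp [ext₁]

lemma tr_eq_bind {I X Y : C} (x : I ⟶ X) (Q : I ⟶ T.obj Y) :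
    lift x Q ≫ tr T X Y = bind Q (lift (fst I Y ≫ x) (snd I Y) ≫ T.η.app (X ⊗ Y)) := by
  have e : lift (fst I Y ≫ x) (snd I Y) ≫ T.η.app (X ⊗ Y) = x ▷ Y ≫ T.η.app (X ⊗ Y) := by
    congr 1; ext <;> simp
  rw [e, ← lift_bind_tr]
  simp

lemma fubini'_eq_bind {I X Y : C} (P : I ⟶ T.obj X) (Q : I ⟶ T.obj Y) :
    lift P Q ≫ fubini' T X Y =
      bind P (bind (fst I X ≫ Q) ((α_ I X Y).hom ≫ snd I (X ⊗ Y) ≫ T.η.app (X ⊗ Y))) := by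
  have := ext₁_eq_bind P Q (tr T X Y)
  rw [tr_eq_bind] at this
  change lift P Q ≫ ext₁ T (tr T X Y) = _
  rw [this]
  congr 2
  rw [← Category.assoc]; congr 1; ext <;> simp

lemma fubini_eq_bind {I X Y : C} (P : I ⟶ T.obj X) (Q : I ⟶ T.obj Y) :
    lift P Q ≫ fubini T X Y =
      bind Q (bind (fst I Y ≫ P) (lift (snd _ X) (fst _ X ≫ snd I Y) ≫ T.η.app (X ⊗ Y))) := by
  have := lift_bind_tr P Q (tl T X Y)
  have e : P ▷ Y = lift (fst I Y ≫ P) (snd I Y) := by ext <;> simp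
  rw [e, tl_eq_bind] at this
  exact this

variable [IsCommutative T]

/-- Fubini's theorem: the two Fubini maps are the iterated integrals of `η` in the two orders, and
integrating `k` against both extends their equality to arbitrary integrands. -/
lemma bind_comm {I X Y Z : C} (P : I ⟶ T.obj X) (Q : I ⟶ T.obj Y) (k : (I ⊗ X) ⊗ Y ⟶ T.obj Z) :
    bind P (bind (fst I X ≫ Q) k) =
      bind Q (bind (fst I Y ≫ P)
        (lift (lift (fst _ X ≫ fst I Y) (snd _ X)) (fst _ X ≫ snd I Y) ≫ k)) := by
  have h := congr(bind (lift P Q ≫ $(IsCommutative.fubini_eq (T := T) X Y)) ((α_ I X Y).inv ≫ k))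
  rw [fubini_eq_bind, fubini'_eq_bind] at h
  rw [bind_assoc, bind_assoc, bind_assoc, bind_assoc] at h
  simp only [← Category.assoc _ _ (T.η.app _), η_bind] at h
  convert h.symm using 3
  · simp only [← Category.assoc]; convert (Category.id_comp k).symm using 2; ext <;> simp
  · simp only [← Category.assoc]; congr 1; ext <;> simp

/-- A scalar is a distribution on the point, so scaling `P` integrates the constant family `P`
against it. The module laws become laws of `bind`. -/
lemma smul_eq_bind {I X : C} (r : I ⟶ R T) (P : I ⟶ T.obj X) :
    smul r P = bind r (fst I (𝟙_ C) ≫ P) := by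
  rw [smul, act, IsCommutative.fubini_eq, ← Category.assoc, fubini'_eq_bind, map_eq_bind,
    bind_assoc, bind_assoc]
  simp only [← Category.assoc _ _ (T.η.app _), η_bind]
  congr 1
  conv_rhs => rw [← bind_η (fst I (𝟙_ C) ≫ P)]
  congr 1
  rw [leftUnitor_hom]; simp only [← Category.assoc]; congr 1
  simp only [Category.assoc, whiskerRight_snd, lift_snd_assoc]
  exact associator_hom_snd_snd _ _ _

omit [IsCommutative T] in
lemma comp_smul {I J X : C} (f : J ⟶ I) (r : I ⟶ R T) (P : I ⟶ T.obj X) :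
    f ≫ smul r P = smul (f ≫ r) (f ≫ P) := by
  simp [smul, ← Category.assoc]

lemma bind_smul {I X Y : C} (r : I ⟶ R T) (P : I ⟶ T.obj X) (k : I ⊗ X ⟶ T.obj Y) :
    bind P (smul (fst I X ≫ r) k) = smul r (bind P k) := by
  rw [smul_eq_bind, smul_eq_bind, bind_comm, comp_bind]
  congr 2
  simp only [← Category.assoc]; congr 1; ext <;> simp

lemma smul_bind {I X Y : C} (r : I ⟶ R T) (P : I ⟶ T.obj X) (k : I ⊗ X ⟶ T.obj Y) :
    bind (smul r P) k = smul r (bind P k) := by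
  rw [smul_eq_bind, smul_eq_bind, bind_assoc, comp_bind]

lemma smul_smul {I X : C} (r s : I ⟶ R T) (P : I ⟶ T.obj X) :
    smul (smul r s) P = smul r (smul s P) := by
  rw [smul_eq_bind, smul_bind, ← smul_eq_bind]

lemma one_smul {I X : C} (P : I ⟶ T.obj X) : smul (toUnit I ≫ T.η.app (𝟙_ C)) P = P := by
  rw [smul_eq_bind, η_bind]
  simp

end Bind

/-! ### Linear extension without parameters. -/

section LinExt

variable {C : Type u} [Category.{v} C] {T : Monad C}

lemma map_comp_linExt {X Y Z : C} (f : X ⟶ Y) (g : Y ⟶ T.obj Z) :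
    T.map f ≫ linExt T g = linExt T (f ≫ g) := by
  simp [linExt]

lemma linExt_comp_map {X Y Z : C} (f : X ⟶ T.obj Y) (g : Y ⟶ Z) :
    linExt T f ≫ T.map g = linExt T (f ≫ T.map g) := by
  have := T.μ.naturality g
  simp only [Functor.comp_map] at this
  simp [linExt, this]

lemma linExt_η (X : C) : linExt T (T.η.app X) = 𝟙 (T.obj X) := by simp [linExt]

lemma map_eq_linExt {X Y : C} (f : X ⟶ Y) : T.map f = linExt T (f ≫ T.η.app Y) := by
  rw [← map_comp_linExt, linExt_η, Category.comp_id]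

end LinExt

/-! ### Distributivity of products over coproducts, from exponentials. -/

section TensorCoprod

variable {C : Type u} [Category.{v} C] [MonoidalCategory C] [MonoidalClosed C]
  [HasBinaryCoproducts C]

/-- The map out of `I × (X + Y)` given by its restrictions to `I × X` and `I × Y`. -/
noncomputable def copair {I X Y Z : C} (k : I ⊗ X ⟶ Z) (l : I ⊗ Y ⟶ Z) : I ⊗ (X ⨿ Y) ⟶ Z :=
  MonoidalClosed.uncurry (coprod.desc (MonoidalClosed.curry k) (MonoidalClosed.curry l))

lemma inl_copair {I X Y Z : C} (k : I ⊗ X ⟶ Z) (l : I ⊗ Y ⟶ Z) :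
    I ◁ coprod.inl ≫ copair k l = k := by
  rw [copair, ← MonoidalClosed.uncurry_natural_left, coprod.inl_desc,
    MonoidalClosed.uncurry_curry]

lemma inr_copair {I X Y Z : C} (k : I ⊗ X ⟶ Z) (l : I ⊗ Y ⟶ Z) :
    I ◁ coprod.inr ≫ copair k l = l := by
  rw [copair, ← MonoidalClosed.uncurry_natural_left, coprod.inr_desc,
    MonoidalClosed.uncurry_curry]

lemma eq_copair {I X Y Z : C} {f : I ⊗ (X ⨿ Y) ⟶ Z} {k : I ⊗ X ⟶ Z} {l : I ⊗ Y ⟶ Z}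
    (hl : I ◁ coprod.inl ≫ f = k) (hr : I ◁ coprod.inr ≫ f = l) : f = copair k l := by
  apply MonoidalClosed.curry_injective
  apply coprod.hom_ext
  · rw [← MonoidalClosed.curry_natural_left, hl, copair, MonoidalClosed.curry_uncurry,
      coprod.inl_desc]
  · rw [← MonoidalClosed.curry_natural_left, hr, copair, MonoidalClosed.curry_uncurry,
      coprod.inr_desc]

lemma copair_comp {I X Y Z W : C} (k : I ⊗ X ⟶ Z) (l : I ⊗ Y ⟶ Z) (f : Z ⟶ W) :
    copair k l ≫ f = copair (k ≫ f) (l ≫ f) :=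
  eq_copair (by rw [← Category.assoc, inl_copair]) (by rw [← Category.assoc, inr_copair])

end TensorCoprod

/-! ### Additive structure of `T(X)` and its compatibility with `bind`. -/

section Additive

variable {C : Type u} [Category.{v} C] [CartesianMonoidalCategory C]

section Zero

variable [HasInitial C] {T : Monad C} [HasZeroAlg T]

lemma comp_zero {I J : C} (f : J ⟶ I) (X : C) : f ≫ zero T I X = zero T J X := by
  simp [zero, ← Category.assoc]

lemma initial_alg_hom_ext {I : C} (P Q : I ⟶ T.obj (⊥_ C)) : P = Q := by
  rw [← cancel_mono (toUnit (T.obj (⊥_ C)))]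
  exact toUnit_unique _ _

lemma linExt_initial {I X : C} (P : I ⟶ T.obj (⊥_ C)) (f : ⊥_ C ⟶ T.obj X) :
    P ≫ linExt T f = zero T I X := by
  have : f = initial.to X ≫ T.η.app X := Subsingleton.elim _ _
  rw [zero, ← Category.assoc,
    initial_alg_hom_ext P (toUnit I ≫ inv (toUnit (T.obj (⊥_ C)))), this, map_eq_linExt]

lemma comp_linExt_zero {I X : C} (P : I ⟶ T.obj X) (Y : C) :
    P ≫ linExt T (zero T X Y) = zero T I Y := by
  have : zero T X Y = (toUnit X ≫ inv (toUnit (T.obj (⊥_ C)))) ≫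
      linExt T (initial.to Y ≫ T.η.app Y) := by rw [zero, ← map_eq_linExt, Category.assoc]
  have h : linExt T (zero T X Y) = linExt T (toUnit X ≫ inv (toUnit (T.obj (⊥_ C)))) ≫
      linExt T (initial.to Y ≫ T.η.app Y) := by
    rw [← map_eq_linExt, linExt_comp_map, map_eq_linExt, this]
  rw [h, ← Category.assoc, linExt_initial]

variable [Strength T]

lemma zero_bind [MonoidalClosed C] {I X Y : C} (k : I ⊗ X ⟶ T.obj Y) :
    bind (zero T I X) k = zero T I Y := by
  rw [zero, ← Category.assoc, map_eq_bind, bind_assoc,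
    ← linExt_initial (toUnit I ≫ inv (toUnit (T.obj (⊥_ C)))) (initial.to _), linExt_eq_bind]
  congr 1
  -- By currying, `I × ∅` admits at most one map to any object.
  apply MonoidalClosed.curry_injective
  exact Subsingleton.elim _ _

end Zero

section Add

variable [HasInitial C] [HasBinaryCoproducts C] {T : Monad C} [HasBiprodAlg T]

lemma comp_add {I J X : C} (f : J ⟶ I) (P Q : I ⟶ T.obj X) :
    f ≫ add P Q = add (f ≫ P) (f ≫ Q) := by
  simp [add, ← Category.assoc]

/-- The generalized element of `T(X + Y)` with components `P` and `Q`. -/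
noncomputable def pair {I X Y : C} (P : I ⟶ T.obj X) (Q : I ⟶ T.obj Y) : I ⟶ T.obj (X ⨿ Y) :=
  lift P Q ≫ inv (biprodMap T X Y)

lemma pair_biprodMap {I X Y : C} (P : I ⟶ T.obj X) (Q : I ⟶ T.obj Y) :
    pair P Q ≫ biprodMap T X Y = lift P Q := by simp [pair]

lemma pair_fst {I X Y : C} (P : I ⟶ T.obj X) (Q : I ⟶ T.obj Y) :
    pair P Q ≫ linExt T (coprod.desc (T.η.app X) (zero T Y X)) = P := by
  simpa [biprodMap] using congr($(pair_biprodMap P Q) ≫ fst _ _)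

lemma pair_snd {I X Y : C} (P : I ⟶ T.obj X) (Q : I ⟶ T.obj Y) :
    pair P Q ≫ linExt T (coprod.desc (zero T X Y) (T.η.app Y)) = Q := by
  simpa [biprodMap] using congr($(pair_biprodMap P Q) ≫ snd _ _)

lemma eq_pair {I X Y : C} {P : I ⟶ T.obj X} {Q : I ⟶ T.obj Y} {W : I ⟶ T.obj (X ⨿ Y)}
    (hP : W ≫ linExt T (coprod.desc (T.η.app X) (zero T Y X)) = P)
    (hQ : W ≫ linExt T (coprod.desc (zero T X Y) (T.η.app Y)) = Q) : W = pair P Q := by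
  rw [← cancel_mono (biprodMap T X Y), pair_biprodMap]
  ext
  · simpa [biprodMap] using hP
  · simpa [biprodMap] using hQ

lemma add_eq_pair {I X : C} (P Q : I ⟶ T.obj X) :
    add P Q = pair P Q ≫ T.map (coprod.desc (𝟙 X) (𝟙 X)) := by
  simp [add, addMap, pair]

lemma add_zero {I X : C} (P : I ⟶ T.obj X) : add P (zero T I X) = P := by
  have : P ≫ T.map coprod.inl = pair P (zero T I X) := by
    apply eq_pair
    · rw [Category.assoc, map_comp_linExt, coprod.inl_desc, linExt_η]; simp
    · rw [Category.assoc, map_comp_linExt, coprod.inl_desc, comp_linExt_zero]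
  rw [add_eq_pair, ← this, Category.assoc, ← T.map_comp, coprod.inl_desc]
  simp

lemma zero_add {I X : C} (P : I ⟶ T.obj X) : add (zero T I X) P = P := by
  have : P ≫ T.map coprod.inr = pair (zero T I X) P := by
    apply eq_pair
    · rw [Category.assoc, map_comp_linExt, coprod.inr_desc, comp_linExt_zero]
    · rw [Category.assoc, map_comp_linExt, coprod.inr_desc, linExt_η]; simp
  rw [add_eq_pair, ← this, Category.assoc, ← T.map_comp, coprod.inr_desc]
  simp

variable [Strength T] [MonoidalClosed C]

omit [HasBiprodAlg T] [HasInitial C] in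
lemma bind_linExt_desc {I X Y Z W : C} (V : I ⟶ T.obj (X ⨿ Y)) (f : X ⟶ T.obj Z)
    (g : Y ⟶ T.obj Z) (k : I ⊗ Z ⟶ T.obj W) :
    bind (V ≫ linExt T (coprod.desc f g)) k =
      bind V (copair (bind (snd I X ≫ f) (fst I X ▷ Z ≫ k))
        (bind (snd I Y ≫ g) (fst I Y ▷ Z ≫ k))) := by
  rw [linExt_eq_bind, bind_assoc]
  congr 1
  apply eq_copair
  · rw [comp_bind, ← Category.assoc, whiskerLeft_snd, Category.assoc, coprod.inl_desc,
      ← Category.assoc (_ ▷ _), ← comp_whiskerRight, whiskerLeft_fst]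
  · rw [comp_bind, ← Category.assoc, whiskerLeft_snd, Category.assoc, coprod.inr_desc,
      ← Category.assoc (_ ▷ _), ← comp_whiskerRight, whiskerLeft_fst]

omit [HasBiprodAlg T] [HasInitial C] [HasBinaryCoproducts C] [MonoidalClosed C] in
lemma bind_linExt {I X Y Z : C} (P : I ⟶ T.obj X) (k : I ⊗ X ⟶ T.obj Y) (f : Y ⟶ T.obj Z) :
    bind P k ≫ linExt T f = bind P (k ≫ linExt T f) := by
  rw [linExt_eq_bind, linExt_eq_bind, bind_assoc]; simp

omit [HasBiprodAlg T] [HasInitial C] [HasBinaryCoproducts C] [MonoidalClosed C] in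
lemma snd_η_bind {I X Y : C} (k : I ⊗ X ⟶ T.obj Y) :
    bind (snd I X ≫ T.η.app X) (fst I X ▷ X ≫ k) = k := by
  rw [η_bind, ← Category.assoc]
  convert Category.id_comp k using 2
  ext <;> simp

/-- A sum is a pair pushed along the codiagonal, so it suffices that integration respects pairs; the
parameter forces the use of `copair`. -/
lemma add_bind {I X Y : C} (P Q : I ⟶ T.obj X) (k : I ⊗ X ⟶ T.obj Y) :
    bind (add P Q) k = add (bind P k) (bind Q k) := by
  -- Two copies of `k`, one in each summand, integrated against the pair; the components are
  -- compared one at a time.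
  have hp : bind (pair P Q) (copair (k ≫ T.map coprod.inl) (k ≫ T.map coprod.inr)) =
      pair (bind P k) (bind Q k) := by
    apply eq_pair
    · conv_rhs => rw [← pair_fst P Q, bind_linExt_desc, snd_η_bind, comp_zero, zero_bind]
      rw [bind_linExt, copair_comp, Category.assoc, Category.assoc, map_comp_linExt,
        map_comp_linExt, coprod.inl_desc, coprod.inr_desc, linExt_η, comp_linExt_zero,
        Category.comp_id]
    · conv_rhs => rw [← pair_snd P Q, bind_linExt_desc, snd_η_bind, comp_zero, zero_bind]
      rw [bind_linExt, copair_comp, Category.assoc, Category.assoc, map_comp_linExt,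
        map_comp_linExt, coprod.inl_desc, coprod.inr_desc, linExt_η, comp_linExt_zero,
        Category.comp_id]
  rw [add_eq_pair (bind P k), ← hp, add_eq_pair, map_eq_linExt (coprod.desc (𝟙 X) _),
    map_eq_linExt (coprod.desc (𝟙 Y) _), bind_linExt,
    coprod.desc_comp, bind_linExt_desc, copair_comp, coprod.desc_comp]
  simp only [Category.id_comp, snd_η_bind, Category.assoc]
  rw [map_comp_linExt, map_comp_linExt, coprod.inl_desc, coprod.inr_desc, linExt_η,
    Category.comp_id]

omit [MonoidalClosed C] in
lemma bind_add {I X Y : C} (P : I ⟶ T.obj X) (k l : I ⊗ X ⟶ T.obj Y) :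
    bind P (add k l) = add (bind P k) (bind P l) := by
  have hp : bind P (pair k l) = pair (bind P k) (bind P l) := by
    apply eq_pair <;> rw [bind_linExt]
    · rw [pair_fst]
    · rw [pair_snd]
  rw [add_eq_pair, add_eq_pair, ← hp, map_eq_linExt, bind_linExt]

lemma add_linExt {I X Y : C} (P Q : I ⟶ T.obj X) (f : X ⟶ T.obj Y) :
    add P Q ≫ linExt T f = add (P ≫ linExt T f) (Q ≫ linExt T f) := by
  simp only [linExt_eq_bind, add_bind]

/-- Linear maps preserve sums, and addition comes from a linear map on pairs. With the zero laws,
this interchange yields commutativity and associativity by Eckmann–Hilton. -/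
lemma add_add_add_comm {I X : C} (P Q P' Q' : I ⟶ T.obj X) :
    add (add P Q) (add P' Q') = add (add P P') (add Q Q') := by
  have : add (pair P P') (pair Q Q') = pair (add P Q) (add P' Q') := by
    apply eq_pair <;> rw [add_linExt]
    · rw [pair_fst, pair_fst]
    · rw [pair_snd, pair_snd]
  rw [add_eq_pair (add P Q), ← this, map_eq_linExt, add_linExt, ← map_eq_linExt, ← add_eq_pair,
    ← add_eq_pair]

lemma add_comm {I X : C} (P Q : I ⟶ T.obj X) : add P Q = add Q P := by
  simpa only [add_zero, zero_add] using add_add_add_comm (zero T I X) P Q (zero T I X)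

lemma add_assoc {I X : C} (P Q S : I ⟶ T.obj X) : add (add P Q) S = add P (add Q S) := by
  simpa only [add_zero, zero_add] using add_add_add_comm P Q (zero T I X) S

variable [IsCommutative T]

lemma add_smul {I X : C} (r s : I ⟶ R T) (P : I ⟶ T.obj X) :
    smul (add r s) P = add (smul r P) (smul s P) := by
  simp only [smul_eq_bind, add_bind]

omit [MonoidalClosed C] in
lemma smul_add {I X : C} (r : I ⟶ R T) (P Q : I ⟶ T.obj X) :
    smul r (add P Q) = add (smul r P) (smul r Q) := by
  simp only [smul_eq_bind, comp_add, bind_add]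

lemma zero_smul {I X : C} (P : I ⟶ T.obj X) : smul (zero T I (𝟙_ C)) P = zero T I X := by
  rw [smul_eq_bind, zero_bind]

end Add

section Sub

variable [HasInitial C] [HasBinaryCoproducts C] {T : Monad C} [IsAdditive T] [Strength T]
  [MonoidalClosed C] [IsCommutative T]

lemma add_negOne_smul {I X : C} (P : I ⟶ T.obj X) :
    add P (smul (toUnit I ≫ negOne T) P) = zero T I X := by
  have h : add (T.η.app (𝟙_ C)) (negOne T) = zero T (𝟙_ C) (𝟙_ C) :=
    (IsAdditive.exists_neg_one (T := T)).choose_spec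
  conv_lhs => arg 1; rw [← one_smul P]
  rw [← add_smul, ← comp_add, h, comp_zero, zero_smul]

lemma add_right_cancel {I X : C} {P Q S : I ⟶ T.obj X} (h : add P S = add Q S) : P = Q := by
  have := congr(add $h (smul (toUnit I ≫ negOne T) S))
  simpa only [add_assoc, add_negOne_smul, add_zero] using this

lemma sub_add_cancel {I X : C} (P Q : I ⟶ T.obj X) : add (sub P Q) Q = P := by
  rw [sub, add_assoc, add_comm _ Q, add_negOne_smul, add_zero]

end Sub

end Additive

/-! ### The action of functions on distributions as an integral. -/

section Dash

variable {C : Type u} [Category.{v} C] [CartesianMonoidalCategory C] [MonoidalClosed C]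
  {T : Monad C} [Strength T] [IsCommutative T]

lemma lift_rho {I X : C} (x : I ⟶ X) (ψ : I ⟶ (ihom X).obj (R T)) :
    lift x ψ ≫ rho T X = smul (lift x ψ ≫ ev X (R T)) (x ≫ T.η.app X) := by
  have e : lift x ψ ≫ rho T X =
      (lift (lift x ψ ≫ ev X (R T)) x ≫ tl T (𝟙_ C) X) ≫ T.map (λ_ X).hom := by
    simp only [rho, ← Category.assoc]; congr 2; ext <;> simp
  rw [e, tl_eq_bind, map_eq_bind, bind_assoc, η_bind, smul_eq_bind]
  congr 1
  rw [leftUnitor_hom]; simp only [← Category.assoc]; congr 1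
  simp only [Category.assoc, whiskerRight_snd, lift_snd]

lemma dash_eq_bind {I X : C} (P : I ⟶ T.obj X) (φ : I ⟶ (ihom X).obj (R T)) :
    dash P φ = bind P (smul (lift (snd I X) (fst I X ≫ φ) ≫ ev X (R T))
      (snd I X ≫ T.η.app X)) := by
  rw [dash, dashMap, ext₁_eq_bind, lift_rho]

omit [IsCommutative T] in
lemma comp_dash {I J X : C} (f : J ⟶ I) (P : I ⟶ T.obj X) (φ : I ⟶ (ihom X).obj (R T)) :
    f ≫ dash P φ = dash (f ≫ P) (f ≫ φ) := by
  simp [dash, ← Category.assoc]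

lemma smul_dash {I X : C} (r : I ⟶ R T) (P : I ⟶ T.obj X) (φ : I ⟶ (ihom X).obj (R T)) :
    dash (smul r P) φ = smul r (dash P φ) := by
  simp only [dash_eq_bind, smul_bind]

lemma add_dash [HasInitial C] [HasBinaryCoproducts C] [HasBiprodAlg T] {I X : C}
    (P Q : I ⟶ T.obj X) (φ : I ⟶ (ihom X).obj (R T)) :
    dash (add P Q) φ = add (dash P φ) (dash Q φ) := by
  simp only [dash_eq_bind, add_bind]

omit [Strength T] [IsCommutative T] in
lemma lift_curry_ev {I J X Y : C} (x : J ⟶ X) (i : J ⟶ I) (g : X ⊗ I ⟶ Y) :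
    lift x (i ≫ MonoidalClosed.curry g) ≫ ev X Y = lift x i ≫ g := by
  have h : X ◁ MonoidalClosed.curry g ≫ ev X Y = g := by
    rw [ev, ← MonoidalClosed.uncurry_eq, MonoidalClosed.uncurry_curry]
  conv_rhs => rw [← h, ← Category.assoc]
  congr 1; ext <;> simp

end Dash

/-! ### Translations, derivatives and the product rule. -/

section Derivative

variable {C : Type u} [Category.{v} C] [CartesianMonoidalCategory C]
  [HasInitial C] [HasBinaryCoproducts C] {T : Monad C} [Strength T]

section Translate

variable [IsAdditive T]

lemma translate_eq_bind {I : C} (u : I ⟶ R T) (P : I ⟶ T.obj (R T)) :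
    translate u P = bind P (add (snd I (R T)) (fst I (R T) ≫ u) ≫ T.η.app (R T)) := by
  rw [translate, ← Category.assoc, tl_eq_bind, map_eq_bind, bind_assoc, η_bind]
  congr 1
  simp only [← Category.assoc, add]; congr 2; ext <;> simp

lemma comp_translate {I J : C} (f : J ⟶ I) (u : I ⟶ R T) (P : I ⟶ T.obj (R T)) :
    f ≫ translate u P = translate (f ≫ u) (f ≫ P) := by
  simp [translate, ← Category.assoc]

lemma translate_zero {I : C} (P : I ⟶ T.obj (R T)) :
    translate (zero T I (𝟙_ C)) P = P := by
  rw [translate_eq_bind, comp_zero, add_zero, bind_η]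

variable [MonoidalClosed C] [IsCommutative T]

lemma translate_dash {I : C} (u : I ⟶ R T) (P : I ⟶ T.obj (R T))
    (φ : I ⟶ (ihom (R T)).obj (R T)) :
    translate u (dash P φ) = bind P (smul (lift (snd _ _) (fst _ _ ≫ φ) ≫ ev (R T) (R T))
      (add (snd _ _) (fst _ _ ≫ u) ≫ T.η.app (R T))) := by
  rw [translate_eq_bind, dash_eq_bind, bind_assoc, smul_bind, η_bind]
  congr 2
  simp only [← Category.assoc, comp_add]; simp

lemma dash_translate {I : C} (u : I ⟶ R T) (P : I ⟶ T.obj (R T))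
    (φ : I ⟶ (ihom (R T)).obj (R T)) :
    dash (translate u P) φ =
      bind P (smul (lift (add (snd _ _) (fst _ _ ≫ u)) (fst _ _ ≫ φ) ≫ ev (R T) (R T))
      (add (snd _ _) (fst _ _ ≫ u) ≫ T.η.app (R T))) := by
  rw [translate_eq_bind, dash_eq_bind, bind_assoc, η_bind, comp_smul, comp_smul]
  congr 2
  · simp only [← Category.assoc]; congr 1; ext <;> simp
  · simp only [← Category.assoc]; congr 1; simp

end Translate

variable [IsAdditive T] {D : Infinitesimals T}

lemma isSlope_slope {I X : C} (h : IsKL D X) (F : I ⊗ D.obj ⟶ T.obj X) :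
    IsSlope D F (slope h F) := (h F).choose_spec.1

lemma slope_eq {I X : C} (h : IsKL D X) {F : I ⊗ D.obj ⟶ T.obj X} {f' : I ⟶ T.obj X}
    (hf : IsSlope D F f') : slope h F = f' := ((h F).choose_spec.2 f' hf).symm

lemma translate_at_zero {I : C} (P : I ⟶ T.obj (R T)) :
    lift (fst I D.obj) (toUnit _ ≫ D.pt) ≫ translate (snd I D.obj ≫ D.ι) (fst I D.obj ≫ P) =
      fst I D.obj ≫ P := by
  rw [comp_translate, lift_snd_assoc, lift_fst_assoc, Category.assoc, D.pt_ι, comp_zero,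
    translate_zero]

lemma translate_eq_add_smul_distDeriv (h : IsKL D (R T)) {I : C} (P : I ⟶ T.obj (R T)) :
    translate (snd I D.obj ≫ D.ι) (fst I D.obj ≫ P) =
      add (fst I D.obj ≫ P) (smul (snd I D.obj ≫ D.ι) (fst I D.obj ≫ distDeriv h P)) := by
  have := isSlope_slope h (translate (snd I D.obj ≫ D.ι) (fst I D.obj ≫ P))
  rwa [IsSlope, translate_at_zero] at this

variable [MonoidalClosed C]

/-- The slope equation, stated for the generic point of `R × I × D`, is pulled back along `(x, i,
d)`. -/
lemma ev_add_eq_add_smul_funDeriv {X : C} (h : IsKL D X) {I J : C}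
    (φ : I ⟶ (ihom (R T)).obj (T.obj X)) (x : J ⟶ R T) (i : J ⟶ I) (d : J ⟶ D.obj) :
    lift (add x (d ≫ D.ι)) (i ≫ φ) ≫ ev (R T) (T.obj X) =
      add (lift x (i ≫ φ) ≫ ev (R T) (T.obj X))
        (smul (d ≫ D.ι) (lift x (i ≫ funDeriv h φ) ≫ ev (R T) (T.obj X))) := by
  rw [funDeriv, lift_curry_ev]
  set F := lift (add (fst _ D.obj ≫ fst (R T) I) (snd _ D.obj ≫ D.ι))
      (fst _ D.obj ≫ snd (R T) I ≫ φ) ≫ ev (R T) (T.obj X) with hF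
  have e : IsSlope D F (slope h F) := isSlope_slope h F
  have e' := congr(lift (lift x i) d ≫ $e)
  rw [comp_add, comp_smul] at e'
  have hx : lift (lift x i) d ≫ F =
      lift (add x (d ≫ D.ι)) (i ≫ φ) ≫ ev (R T) (T.obj X) := by
    rw [hF, ← Category.assoc, comp_lift, comp_add]; simp
  have h0 : lift (lift x i) d ≫ lift (fst (R T ⊗ I) D.obj) (toUnit _ ≫ D.pt) ≫ F =
      lift x (i ≫ φ) ≫ ev (R T) (T.obj X) := by
    rw [hF, ← Category.assoc, ← Category.assoc, comp_lift, comp_lift, comp_add]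
    simp [D.pt_ι, comp_zero, add_zero]
  rw [hx, h0] at e'
  simpa using e'

omit [MonoidalClosed C] in
lemma smul_self_of_isSquareZero (hD : D.IsSquareZero) {I : C} (d : I ⟶ D.obj) :
    smul (d ≫ D.ι) (d ≫ D.ι) = zero T I (𝟙_ C) :=
  (hD _).1 ⟨d, rfl⟩

variable [IsCommutative T]

/-- Translating by `d` changes `P` by `d · P'`, which is killed by a further factor `d`. -/
lemma smul_translate (hD : D.IsSquareZero) (h : IsKL D (R T)) {I : C} (P : I ⟶ T.obj (R T)) :
    smul (snd I D.obj ≫ D.ι) (translate (snd I D.obj ≫ D.ι) (fst I D.obj ≫ P)) =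
      smul (snd I D.obj ≫ D.ι) (fst I D.obj ≫ P) := by
  rw [translate_eq_add_smul_distDeriv h, smul_add, ← smul_smul, smul_self_of_isSquareZero hD,
    zero_smul, add_zero]

lemma dash_translate_eq_add (h : IsKL D (𝟙_ C)) {I : C} (P : I ⟶ T.obj (R T))
    (φ : I ⟶ (ihom (R T)).obj (R T)) :
    dash (translate (snd I D.obj ≫ D.ι) (fst I D.obj ≫ P)) (fst I D.obj ≫ φ) =
      add (translate (snd I D.obj ≫ D.ι) (fst I D.obj ≫ dash P φ))
        (smul (snd I D.obj ≫ D.ι)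
          (translate (snd I D.obj ≫ D.ι) (fst I D.obj ≫ dash P (funDeriv h φ)))) := by
  have e := ev_add_eq_add_smul_funDeriv h φ (snd (I ⊗ D.obj) (R T)) (fst _ _ ≫ fst _ _)
    (fst _ _ ≫ snd _ _)
  simp only [Category.assoc] at e
  rw [dash_translate, e, add_smul, bind_add, comp_dash, comp_dash, translate_dash,
    translate_dash, smul_smul]
  congr 1
  rw [← bind_smul]

theorem distDeriv_dash (hD : D.IsSquareZero) (hR : IsKL D (R T)) (h1 : IsKL D (𝟙_ C)) {I : C}
    (P : I ⟶ T.obj (R T)) (φ : I ⟶ (ihom (R T)).obj (R T)) :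
    distDeriv hR (dash P φ) = sub (dash (distDeriv hR P) φ) (dash P (funDeriv h1 φ)) := by
  apply slope_eq
  rw [IsSlope, translate_at_zero]
  -- Adding the correction term from `dash_translate_eq_add` turns the left side into `α^d_*(P) ⊢
  -- φ`; on the right it cancels the subtracted `d · (P ⊢ φ')`.
  apply add_right_cancel (S := smul (snd I D.obj ≫ D.ι)
    (translate (snd I D.obj ≫ D.ι) (fst I D.obj ≫ dash P (funDeriv h1 φ))))
  rw [← dash_translate_eq_add, smul_translate hD hR, add_assoc, ← smul_add, ← comp_add,
    sub_add_cancel, translate_eq_add_smul_distDeriv hR, add_dash, smul_dash, comp_dash, comp_dash]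

end Derivative

end SynthDist

theorem mainTheorem11 {C : Type u} [Category.{v} C] [CartesianMonoidalCategory C]
    [MonoidalClosed C] [HasInitial C] [HasBinaryCoproducts C]
    (T : Monad C) [SynthDist.Strength T] [SynthDist.IsCommutative T] [SynthDist.IsAdditive T]
    (D : SynthDist.Infinitesimals T) (hD : D.IsSquareZero)
    (hKL : ∀ X : C, SynthDist.IsKL D X)
    {I : C} (P : I ⟶ T.obj (SynthDist.R T))
    (φ : I ⟶ (ihom (SynthDist.R T)).obj (SynthDist.R T)) :
    SynthDist.distDeriv (hKL (SynthDist.R T)) (SynthDist.dash P φ) =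
      SynthDist.sub
        (SynthDist.dash (SynthDist.distDeriv (hKL (SynthDist.R T)) P) φ)
        (SynthDist.dash P (SynthDist.funDeriv (hKL (𝟙_ C)) φ)) :=
  SynthDist.distDeriv_dash hD _ _ P φ
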